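/- Let $\alpha\in(0,1]$, $\lambda>0$, $\mu>0$, $\xi\ge 0$. Let $\{X^\alpha_t\}_{t\ge 0}$ be the fractional $M/M/1$ queue with catastrophes, that is, an $\mathbb{N}_0$-valued stochastic process on a probability space such that, for every $i$ with $P(X^\alpha_0=i)>0$, the transition probabilities $P^\alpha_{i,n}(t):=P(X^\alpha_t=n\mid X^\alpha_0=i)$ are continuous in $t\ge 0$ and satisfy, for all $t>0$ and $n\ge 1$, $$D^\alpha_tP^\alpha_{i,0}(t)=-(\lambda+\xi)P^\alpha_{i,0}(t)+\mu P^\alpha_{i,1}(t)+\xi,$$ $$D^\alpha_tP^\alpha_{i,n}(t)=-(\lambda+\mu+\xi)P^\alpha_{i,n}(t)+\lambda P^\alpha_{i,n-1}(t)+\mu P^\alpha_{i,n+1}(t),$$ with $P^\alpha_{i,n}(0)=\delta_{i,n}$ for all $n\ge0$. Here $D^\alpha_t$ is the Caputo derivative, $D^\alpha_tf=\frac{d}{dt}J^{1-\alpha}(f-f(0))$, where $J^af(t)=\frac1{\Gamma(a)}\int_0^t(t-s)^{a-1}f(s)\,ds$ for $a>0$ and $J^0f=f$ (so $D^1_t=d/dt$).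 Let $$E^\delta_{\beta,\gamma}(w)=\sum_{r=0}^\infty\frac{w^r\,\Gamma(\delta+r)}{r!\,\Gamma(\beta r+\gamma)\,\Gamma(\delta)}$$ be the three-parameter Mittag-Leffler function and $(f\ast g)(t)=\int_0^tf(s)g(t-s)\,ds$. Then for every $t\ge0$ and every $i$ with $P(X^\alpha_0=i)>0$, the expectation $\mathbb{E}[X^\alpha_t]$ of the process started at $i$ (that is, under $P(\,\cdot\mid X^\alpha_0=i)$) is finite, the convolution below converges absolutely, and, if $\xi>0$, $$\mathbb{E}[X^\alpha_t]=i\,E^1_{\alpha,1}(-\xi t^\alpha)+\mu\,\bigl[P^\alpha_{i,0}\ast s^{\alpha-1}E^1_{\alpha,\alpha}(-\xi s^\alpha)\bigr](t)+\frac{\lambda-\mu}{\xi}\bigl(1-E^1_{\alpha,1}(-\xi t^\alpha)\bigr).$$ If $\xi=0$, then $$\mathbb{E}[X^\alpha_t]=i+\mu\,J^\alpha P^\alpha_{i,0}(t)+\frac{(\lambda-\mu)t^\alpha}{\Gamma(\alpha+1)}.$$ If $\alpha=1$ and $\xi>0$, then $$\mathbb{E}[X^1_t]=i\,e^{-\xi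 t}+\mu\int_0^tP^1_{i,0}(s)\,e^{-\xi(t-s)}\,ds+\frac{\lambda-\mu}{\xi}\bigl(1-e^{-\xi t}\bigr).$$ -/

import Mathlib

open MeasureTheory Set
open scoped NNReal Nat

noncomputable section

/-- The three-parameter Mittag-Leffler function
`E^δ_{β,γ}(w) = ∑_{r ≥ 0} w^r Γ(δ+r) / (r! Γ(βr+γ) Γ(δ))` at real arguments. -/
def mittagLeffler (δ β γ w : ℝ) : ℝ :=
  ∑' r : ℕ, w ^ r * Real.Gamma (δ + r) / (r ! * Real.Gamma (β * r + γ) * Real.Gamma δ)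

/-- Convolution in time: `(f ∗ g)(t) = ∫₀ᵗ f(s) g(t-s) ds`. -/
def timeConv (f g : ℝ → ℝ) (t : ℝ) : ℝ :=
  ∫ s in (0 : ℝ)..t, f s * g (t - s)

/-- The Riemann-Liouville fractional integral
`J^a f(t) = Γ(a)⁻¹ ∫₀ᵗ (t-s)^(a-1) f(s) ds` of order `a > 0`; `J^0` is the identity. -/
def rlIntegral (a : ℝ) (f : ℝ → ℝ) (t : ℝ) : ℝ :=
  if a = 0 then f t else (Real.Gamma a)⁻¹ * ∫ s in (0 : ℝ)..t, (t - s) ^ (a - 1) * f s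

/-- For `0 < α ≤ 1` and `f` continuous on `[0, ∞)`, the Caputo derivative of order `α` of `f` exists
at `t > 0` and equals `v`. It is the Riemann-Liouville derivative of `f - f(0)`, that is
`D^α f = d/dt J^(1-α) (f - f(0))`; when `f` is absolutely continuous, this is the function
`t ↦ Γ(1-α)⁻¹ ∫₀ᵗ (t-s)^(-α) f'(s) ds`, and for `α = 1` it is the ordinary derivative. -/
def HasCaputoDerivAt (α : ℝ) (f : ℝ → ℝ) (v t : ℝ) : Prop :=
  HasDerivAt (rlIntegral (1 - α) fun s => f s - f 0) v t

/-- `P_{i,n}(t) = P(X_t = n | X_0 = i)`, as a function of the real variable `t ≥ 0`. -/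
def transProb {Ω : Type*} [MeasurableSpace Ω] (P : Measure Ω) (X : ℝ≥0 → Ω → ℕ)
    (i n : ℕ) (t : ℝ) : ℝ :=
  (ProbabilityTheory.cond P (X 0 ⁻¹' {i})).real (X t.toNNReal ⁻¹' {n})

/-- The fractional `M/M/1` queue with catastrophes: a process `X` with values in `ℕ` whose
transition probabilities, from every state `i` in which it can start, are continuous in time and
satisfy the forward equations with the Caputo derivative of order `α` in time. The rates are `lam`
for arrivals, `μ` for services and `ξ` for catastrophes. -/
structure IsFractionalQueue {Ω : Type*} [MeasurableSpace Ω] (α lam μ ξ : ℝ)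
    (P : Measure Ω) (X : ℝ≥0 → Ω → ℕ) : Prop where
  measurable : ∀ t, Measurable (X t)
  continuousOn : ∀ i, P (X 0 ⁻¹' {i}) ≠ 0 → ∀ n, ContinuousOn (transProb P X i n) (Ici 0)
  caputo_zero : ∀ i, P (X 0 ⁻¹' {i}) ≠ 0 → ∀ t, 0 < t →
    HasCaputoDerivAt α (transProb P X i 0)
      (-(lam + ξ) * transProb P X i 0 t + μ * transProb P X i 1 t + ξ) t
  caputo_pos : ∀ i, P (X 0 ⁻¹' {i}) ≠ 0 → ∀ n, 0 < n → ∀ t, 0 < t →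
    HasCaputoDerivAt α (transProb P X i n)
      (-(lam + μ + ξ) * transProb P X i n t + lam * transProb P X i (n - 1) t
        + μ * transProb P X i (n + 1) t) t
  initial : ∀ i, P (X 0 ⁻¹' {i}) ≠ 0 → ∀ n, transProb P X i n 0 = if i = n then 1 else 0

end

/-!
Summing the forward equations over the states `0, …, n` telescopes. Rewritten as Volterra equations
and summed once more over `n < K`, they show that the truncated mean
`m_K(t) = ∑_{n < K} P(X_t > n | X_0 = i)` satisfies
`m_K = min(K, i) + J^α (-ξ m_K + h_K)` with `h_K = ∑_{n < K} (λ P_{i,n} - μ P_{i,n+1})`.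
Iterating this equation, and using that `J^(α n)` tends to zero because of the factor
`1 / Γ(α n + 1)`, gives `m_K = min(K, i) E_{α,1}(-ξ t^α) + h_K ∗ s^(α-1) E_{α,α}(-ξ s^α)`.
As `K → ∞`, `h_K` stays bounded and tends to `λ - μ + μ P_{i,0}`, so dominated convergence yields
the mean. The constant `λ - μ` contributes `(λ - μ) (1 - E_{α,1}(-ξ t^α)) / ξ`, since
`-ξ (1 ∗ s^(α-1) E_{α,α}(-ξ s^α)) = E_{α,1}(-ξ t^α) - 1`.
-/

open Filter Topology

section TimeConv

theorem timeConv_add_left {f₁ f₂ g : ℝ → ℝ} {t : ℝ}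
    (h₁ : IntervalIntegrable (fun s => f₁ s * g (t - s)) volume 0 t)
    (h₂ : IntervalIntegrable (fun s => f₂ s * g (t - s)) volume 0 t) :
    timeConv (fun s => f₁ s + f₂ s) g t = timeConv f₁ g t + timeConv f₂ g t := by
  simp only [timeConv, add_mul, intervalIntegral.integral_add h₁ h₂]

theorem timeConv_const_mul_left (c : ℝ) (f g : ℝ → ℝ) (t : ℝ) :
    timeConv (fun s => c * f s) g t = c * timeConv f g t := by
  simp only [timeConv, mul_assoc, intervalIntegral.integral_const_mul]

theorem timeConv_congr {f₁ f₂ g₁ g₂ : ℝ → ℝ} {t : ℝ} (ht : 0 ≤ t)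
    (hf : EqOn f₁ f₂ (Ioo 0 t)) (hg : EqOn g₁ g₂ (Ioo 0 t)) :
    timeConv f₁ g₁ t = timeConv f₂ g₂ t := by
  simp only [timeConv, intervalIntegral.integral_of_le ht, integral_Ioc_eq_integral_Ioo]
  refine setIntegral_congr_fun measurableSet_Ioo fun s hs => ?_
  simp only [hf hs, hg ⟨sub_pos.2 hs.2, sub_lt_self t hs.1⟩]

theorem indicator_timeConv (f g : ℝ → ℝ) :
    (Ioi 0).indicator (timeConv f g) = convolution ((Ioi 0).indicator f) ((Ioi 0).indicator g)
      (ContinuousLinearMap.mul ℝ ℝ) volume :=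
  posConvolution_eq_convolution_indicator f g (ContinuousLinearMap.mul ℝ ℝ) volume

theorem convolutionExistsAt_indicator_Ioi {f g : ℝ → ℝ} {x : ℝ}
    (h : 0 < x → IntervalIntegrable (fun s => f s * g (x - s)) volume 0 x) :
    ConvolutionExistsAt ((Ioi 0).indicator f) ((Ioi 0).indicator g) x
      (ContinuousLinearMap.mul ℝ ℝ) volume := by
  have supported : (fun s => (Ioi 0).indicator f s * (Ioi 0).indicator g (x - s)) =
      (Ioo 0 x).indicator fun s => f s * g (x - s) := by
    ext s
    by_cases h0 : 0 < s <;> by_cases h1 : s < x <;> simp [indicator, h0, h1]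
  simp only [ConvolutionExistsAt, ContinuousLinearMap.mul_apply', supported,
    integrable_indicator_iff measurableSet_Ioo]
  rcases le_or_gt x 0 with hx | hx
  · simp [Ioo_eq_empty_of_le hx]
  · exact (intervalIntegrable_iff_integrableOn_Ioo_of_le hx.le).1 (h hx)

theorem timeConv_assoc {f g k : ℝ → ℝ} {t : ℝ} (ht : 0 < t)
    (hf : AEStronglyMeasurable f (volume.restrict (Ioi 0)))
    (hg : AEStronglyMeasurable g (volume.restrict (Ioi 0)))
    (hk : AEStronglyMeasurable k (volume.restrict (Ioi 0)))
    (hfg : ∀ x, 0 < x → IntervalIntegrable (fun s => f s * g (x - s)) volume 0 x)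
    (hgk : ∀ x, 0 < x → IntervalIntegrable (fun s => |g s| * |k (x - s)|) volume 0 x)
    (hfgk : IntervalIntegrable
      (fun s => |f s| * timeConv (fun u => |g u|) (fun u => |k u|) (t - s)) volume 0 t) :
    timeConv (timeConv f g) k t = timeConv f (timeConv g k) t := by
  have norm_indicator (F : ℝ → ℝ) :
      (fun s => ‖(Ioi (0 : ℝ)).indicator F s‖) = (Ioi 0).indicator fun s => |F s| :=
    funext fun s => norm_indicator_eq_indicator_norm F s
  have assoc := convolution_assoc (μ := volume) (ν := volume) (ContinuousLinearMap.mul ℝ ℝ)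
    (ContinuousLinearMap.mul ℝ ℝ) (ContinuousLinearMap.mul ℝ ℝ) (ContinuousLinearMap.mul ℝ ℝ)
    mul_assoc (x₀ := t) ((aestronglyMeasurable_indicator_iff measurableSet_Ioi).2 hf)
    ((aestronglyMeasurable_indicator_iff measurableSet_Ioi).2 hg)
    ((aestronglyMeasurable_indicator_iff measurableSet_Ioi).2 hk)
    (Eventually.of_forall fun x => convolutionExistsAt_indicator_Ioi (hfg x))
    (Eventually.of_forall fun x => by
      rw [norm_indicator, norm_indicator]
      exact convolutionExistsAt_indicator_Ioi (hgk x))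
    (by
      rw [norm_indicator, norm_indicator, norm_indicator, ← indicator_timeConv]
      exact convolutionExistsAt_indicator_Ioi fun _ => hfgk)
  simp only [← indicator_timeConv] at assoc
  simpa [ht] using assoc

end TimeConv

/-- The kernel `s ↦ s^(a-1) / Γ(a)` on `(0, ∞)`, convolution with which is the Riemann-Liouville
integral of order `a > 0`. -/
noncomputable def fracKernel (a s : ℝ) : ℝ :=
  s ^ (a - 1) / Real.Gamma a

section FracKernel

variable {a b t : ℝ}

theorem measurable_fracKernel (a : ℝ) : Measurable (fracKernel a) := by
  unfold fracKernel
  fun_prop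

theorem fracKernel_nonneg (ha : 0 < a) {s : ℝ} (hs : 0 ≤ s) : 0 ≤ fracKernel a s :=
  div_nonneg (Real.rpow_nonneg hs _) (Real.Gamma_pos_of_pos ha).le

theorem fracKernel_pos (ha : 0 < a) {s : ℝ} (hs : 0 < s) : 0 < fracKernel a s :=
  div_pos (Real.rpow_pos_of_pos hs _) (Real.Gamma_pos_of_pos ha)

theorem fracKernel_one (s : ℝ) : fracKernel 1 s = 1 := by
  simp [fracKernel]

theorem integral_rpow_mul_sub_rpow (ha : 0 < a) (hb : 0 < b) (ht : 0 < t) :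
    ∫ s in (0 : ℝ)..t, s ^ (a - 1) * (t - s) ^ (b - 1) =
      t ^ (a + b - 1) * (Real.Gamma a * Real.Gamma b / Real.Gamma (a + b)) := by
  have scaled := Complex.betaIntegral_scaled a b ht
  rw [Complex.betaIntegral_eq_Gamma_mul_div _ _ (by simpa) (by simpa)] at scaled
  have cast_integral : ∫ s in (0 : ℝ)..t, (s : ℂ) ^ ((a : ℂ) - 1) * ((t : ℂ) - s) ^ ((b : ℂ) - 1) =
      ∫ s in (0 : ℝ)..t, ((s ^ (a - 1) * (t - s) ^ (b - 1) : ℝ) : ℂ) := by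
    refine intervalIntegral.integral_congr fun s hs => ?_
    rw [uIcc_of_le ht.le] at hs
    simp only [Complex.ofReal_mul, Complex.ofReal_cpow hs.1,
      Complex.ofReal_cpow (sub_nonneg.2 hs.2)]
    push_cast
    rfl
  rw [cast_integral, intervalIntegral.integral_ofReal, ← Complex.ofReal_add, Complex.Gamma_ofReal,
    Complex.Gamma_ofReal, Complex.Gamma_ofReal, ← Complex.ofReal_one, ← Complex.ofReal_sub,
    ← Complex.ofReal_cpow ht.le] at scaled
  exact_mod_cast scaled

theorem timeConv_fracKernel (ha : 0 < a) (hb : 0 < b) (ht : 0 < t) :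
    timeConv (fracKernel a) (fracKernel b) t = fracKernel (a + b) t := by
  have hΓa := (Real.Gamma_pos_of_pos ha).ne'
  have hΓb := (Real.Gamma_pos_of_pos hb).ne'
  simp only [timeConv, fracKernel, div_mul_div_comm, intervalIntegral.integral_div,
    integral_rpow_mul_sub_rpow ha hb ht]
  field_simp

theorem intervalIntegrable_fracKernel_mul_sub (ha : 0 < a) (hb : 0 < b) (ht : 0 < t) :
    IntervalIntegrable (fun s => fracKernel a s * fracKernel b (t - s)) volume 0 t := by
  refine intervalIntegral.intervalIntegrable_of_integral_ne_zero ?_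
  change timeConv (fracKernel a) (fracKernel b) t ≠ 0
  rw [timeConv_fracKernel ha hb ht]
  exact (fracKernel_pos (add_pos ha hb) ht).ne'

theorem intervalIntegrable_sub_rpow (ha : 0 < a) (t : ℝ) :
    IntervalIntegrable (fun s => (t - s) ^ (a - 1)) volume 0 t := by
  simpa using ((intervalIntegral.intervalIntegrable_rpow' (a := 0) (b := t)
    (by linarith : -1 < a - 1)).comp_sub_left t).symm

theorem intervalIntegrable_mul_fracKernel_sub (ha : 0 < a) {f : ℝ → ℝ}
    (hf : ContinuousOn f (Ici 0)) (ht : 0 ≤ t) :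
    IntervalIntegrable (fun s => f s * fracKernel a (t - s)) volume 0 t := by
  have hf' : ContinuousOn f (uIcc 0 t) := hf.mono (uIcc_of_le ht ▸ Icc_subset_Ici_self)
  exact ((intervalIntegrable_sub_rpow ha t).div_const _).continuousOn_mul hf'

end FracKernel

section RiemannLiouville

variable {a b t C : ℝ} {f g : ℝ → ℝ}

theorem rlIntegral_zero (f : ℝ → ℝ) : rlIntegral 0 f = f := by
  ext t
  simp [rlIntegral]

theorem rlIntegral_eq_timeConv (ha : a ≠ 0) (f : ℝ → ℝ) :
    rlIntegral a f = timeConv f (fracKernel a) := by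
  ext t
  simp only [rlIntegral, if_neg ha, timeConv, fracKernel, inv_mul_eq_div, mul_comm (f _),
    div_mul_eq_mul_div, intervalIntegral.integral_div]

theorem rlIntegral_apply_zero (ha : a ≠ 0) (f : ℝ → ℝ) : rlIntegral a f 0 = 0 := by
  simp [rlIntegral, ha]

theorem rlIntegral_one_apply (f : ℝ → ℝ) (t : ℝ) : rlIntegral 1 f t = ∫ s in (0 : ℝ)..t, f s := by
  simp [rlIntegral]

theorem rlIntegral_const_mul (a c : ℝ) (f : ℝ → ℝ) (t : ℝ) :
    rlIntegral a (fun s => c * f s) t = c * rlIntegral a f t := by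
  rcases eq_or_ne a 0 with rfl | ha
  · simp only [rlIntegral_zero]
  · simp only [rlIntegral_eq_timeConv ha, timeConv_const_mul_left]

theorem rlIntegral_congr (ht : 0 ≤ t) (h : EqOn f g (Icc 0 t)) :
    rlIntegral a f t = rlIntegral a g t := by
  rcases eq_or_ne a 0 with rfl | ha
  · simpa only [rlIntegral_zero] using h ⟨ht, le_rfl⟩
  · simpa only [rlIntegral_eq_timeConv ha] using
      timeConv_congr ht (h.mono Ioo_subset_Icc_self) (eqOn_refl _ _)

theorem rlIntegral_add (ha : 0 ≤ a) (hf : ContinuousOn f (Ici 0)) (hg : ContinuousOn g (Ici 0))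
    (ht : 0 ≤ t) :
    rlIntegral a (fun s => f s + g s) t = rlIntegral a f t + rlIntegral a g t := by
  rcases ha.eq_or_lt with rfl | ha
  · simp only [rlIntegral_zero]
  · simp only [rlIntegral_eq_timeConv ha.ne']
    exact timeConv_add_left (intervalIntegrable_mul_fracKernel_sub ha hf ht)
      (intervalIntegrable_mul_fracKernel_sub ha hg ht)

theorem rlIntegral_sum {ι : Type*} (S : Finset ι) {F : ι → ℝ → ℝ} (ha : 0 ≤ a)
    (hF : ∀ j ∈ S, ContinuousOn (F j) (Ici 0)) (ht : 0 ≤ t) :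
    rlIntegral a (fun s => ∑ j ∈ S, F j s) t = ∑ j ∈ S, rlIntegral a (F j) t := by
  classical
  induction S using Finset.induction_on with
  | empty => simpa using rlIntegral_const_mul a 0 (fun _ => 0) t
  | insert j S hj ih =>
    have hS (k) (hk : k ∈ S) := hF k (Finset.mem_insert_of_mem hk)
    simp only [Finset.sum_insert hj, ← ih hS]
    exact rlIntegral_add ha (hF j (Finset.mem_insert_self j S)) (continuousOn_finsetSum S hS) ht

theorem rlIntegral_const (ha : 0 ≤ a) (c : ℝ) (ht : 0 ≤ t) :
    rlIntegral a (fun _ => c) t = c * (t ^ a / Real.Gamma (a + 1)) := by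
  rcases ha.eq_or_lt with rfl | ha
  · simp [rlIntegral_zero]
  rcases ht.eq_or_lt with rfl | ht
  · simp [rlIntegral_apply_zero, ha.ne']
  calc rlIntegral a (fun _ => c) t = c * timeConv (fracKernel 1) (fracKernel a) t := by
        simp only [← timeConv_const_mul_left, fracKernel_one, mul_one,
          rlIntegral_eq_timeConv ha.ne']
    _ = c * (t ^ a / Real.Gamma (a + 1)) := by
        rw [timeConv_fracKernel one_pos ha ht, fracKernel, add_sub_cancel_left, add_comm]

theorem abs_rlIntegral_le (ha : 0 ≤ a) (hC : ∀ s ∈ Icc 0 t, |f s| ≤ C) (ht : 0 ≤ t) :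
    |rlIntegral a f t| ≤ C * (t ^ a / Real.Gamma (a + 1)) := by
  rw [← rlIntegral_const ha C ht]
  rcases ha.eq_or_lt with rfl | ha
  · simpa only [rlIntegral_zero] using hC t ⟨ht, le_rfl⟩
  simp only [rlIntegral_eq_timeConv ha.ne', timeConv, ← Real.norm_eq_abs (∫ _ in _.._, _)]
  refine intervalIntegral.norm_integral_le_of_norm_le ht (Eventually.of_forall fun s hs => ?_)
    (intervalIntegrable_mul_fracKernel_sub ha continuousOn_const ht)
  have kernel_nonneg := fracKernel_nonneg ha (sub_nonneg.2 hs.2)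
  rw [norm_mul, Real.norm_of_nonneg kernel_nonneg]
  exact mul_le_mul_of_nonneg_right (hC s (Ioc_subset_Icc_self hs)) kernel_nonneg

theorem rlIntegral_eq_rpow_mul (ha : a ≠ 0) (f : ℝ → ℝ) (ht : 0 ≤ t) :
    rlIntegral a f t =
      (Real.Gamma a)⁻¹ * t ^ a * ∫ x in (0 : ℝ)..1, (1 - x) ^ (a - 1) * f (t * x) := by
  rcases ht.eq_or_lt with rfl | ht
  · simp [rlIntegral_apply_zero, ha]
  have rescaled : ∫ s in (0 : ℝ)..t, (t - s) ^ (a - 1) * f s =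
      t * ∫ x in (0 : ℝ)..1, (t - t * x) ^ (a - 1) * f (t * x) := by
    simpa using (intervalIntegral.smul_integral_comp_mul_left (a := 0) (b := 1)
      (fun s => (t - s) ^ (a - 1) * f s) t).symm
  have factored : EqOn (fun x => (t - t * x) ^ (a - 1) * f (t * x))
      (fun x => t ^ (a - 1) * ((1 - x) ^ (a - 1) * f (t * x))) (uIcc 0 1) := by
    intro x hx
    rw [uIcc_of_le zero_le_one] at hx
    simp only [← mul_one_sub, Real.mul_rpow ht.le (sub_nonneg.2 hx.2), mul_assoc]
  rw [rlIntegral, if_neg ha, rescaled, intervalIntegral.integral_congr factored,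
    intervalIntegral.integral_const_mul, Real.rpow_sub_one ht.ne']
  field_simp

theorem continuous_integral_one_sub_rpow_mul (ha : 0 < a) (hf : Continuous f) :
    Continuous fun t => ∫ x in (0 : ℝ)..1, (1 - x) ^ (a - 1) * f (t * x) := by
  refine continuous_iff_continuousAt.2 fun t₀ => ?_
  obtain ⟨C, hC⟩ := (isCompact_Icc (a := -(|t₀| + 1)) (b := |t₀| + 1)).exists_bound_of_continuousOn
    hf.continuousOn
  refine intervalIntegral.continuousAt_of_dominated_interval
    (bound := fun x => (1 - x) ^ (a - 1) * C) (Eventually.of_forall fun t => ?_) ?_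
    ((intervalIntegrable_sub_rpow ha 1).mul_const C)
    (Eventually.of_forall fun x _ => by fun_prop)
  · exact (Measurable.aestronglyMeasurable (by fun_prop)).mul
      (hf.comp (continuous_const_mul t)).aestronglyMeasurable
  · have near : ∀ᶠ t in 𝓝 t₀, |t| < |t₀| + 1 :=
      continuous_abs.continuousAt.eventually_lt_const (lt_add_one _)
    filter_upwards [near] with t ht
    refine Eventually.of_forall fun x hx => ?_
    rw [uIoc_of_le zero_le_one] at hx
    have weight_nonneg := Real.rpow_nonneg (sub_nonneg.2 hx.2) (a - 1)
    rw [norm_mul, Real.norm_of_nonneg weight_nonneg]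
    refine mul_le_mul_of_nonneg_left (hC _ (abs_le.1 ?_)) weight_nonneg
    rw [abs_mul, abs_of_pos hx.1]
    exact (mul_le_of_le_one_right (abs_nonneg t) hx.2).trans ht.le

theorem continuousOn_rlIntegral (ha : 0 ≤ a) (hf : ContinuousOn f (Ici 0)) :
    ContinuousOn (rlIntegral a f) (Ici 0) := by
  rcases ha.eq_or_lt with rfl | ha
  · rwa [rlIntegral_zero]
  have extended : Continuous fun s => f (max s 0) :=
    hf.comp_continuous (by fun_prop) fun s => le_max_right s 0
  have scale : Continuous fun t : ℝ => (Real.Gamma a)⁻¹ * t ^ a :=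
    continuous_const.mul (Real.continuous_rpow_const ha.le)
  refine (scale.mul (continuous_integral_one_sub_rpow_mul ha extended)).continuousOn.congr
    fun t ht => ?_
  rw [rlIntegral_eq_rpow_mul ha.ne' f ht]
  congr 1
  refine intervalIntegral.integral_congr fun x hx => ?_
  rw [uIcc_of_le zero_le_one] at hx
  simp only [max_eq_left (mul_nonneg (mem_Ici.1 ht) hx.1)]

theorem rlIntegral_rlIntegral (ha : 0 ≤ a) (hb : 0 ≤ b) (hf : ContinuousOn f (Ici 0))
    (ht : 0 ≤ t) : rlIntegral a (rlIntegral b f) t = rlIntegral (a + b) f t := by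
  rw [add_comm a b]
  rcases ha.eq_or_lt with rfl | ha
  · rw [rlIntegral_zero, add_zero]
  rcases hb.eq_or_lt with rfl | hb
  · rw [rlIntegral_zero, zero_add]
  rcases ht.eq_or_lt with rfl | ht
  · rw [rlIntegral_apply_zero ha.ne', rlIntegral_apply_zero (add_pos hb ha).ne']
  have kernel_abs {c : ℝ} (hc : 0 < c) (x : ℝ) :
      EqOn (fun s => |fracKernel c s|) (fracKernel c) (Ioo 0 x) :=
    fun s hs => abs_of_nonneg (fracKernel_nonneg hc hs.1.le)
  simp only [rlIntegral_eq_timeConv ha.ne', rlIntegral_eq_timeConv hb.ne',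
    rlIntegral_eq_timeConv (add_pos hb ha).ne']
  rw [timeConv_assoc ht]
  · exact timeConv_congr ht.le (eqOn_refl _ _) fun s hs => timeConv_fracKernel hb ha hs.1
  · exact (hf.mono Ioi_subset_Ici_self).aestronglyMeasurable measurableSet_Ioi
  · exact (measurable_fracKernel b).aestronglyMeasurable
  · exact (measurable_fracKernel a).aestronglyMeasurable
  · exact fun x hx => intervalIntegrable_mul_fracKernel_sub hb hf hx.le
  · intro x hx
    simpa only [abs_mul] using (intervalIntegrable_fracKernel_mul_sub hb ha hx).abs
  · refine (intervalIntegrable_mul_fracKernel_sub (add_pos hb ha) hf.abs ht.le).congr_uIoo ?_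
    intro s hs
    rw [uIoo_of_le ht.le] at hs
    have hts := sub_pos.2 hs.2
    simp only [timeConv_congr hts.le (kernel_abs hb _) (kernel_abs ha _),
      timeConv_fracKernel hb ha hts]

theorem eq_of_rlIntegral_one_eq (hf : ContinuousOn f (Ici 0)) (hg : ContinuousOn g (Ici 0))
    (h : EqOn (rlIntegral 1 f) (rlIntegral 1 g) (Ici 0)) : EqOn f g (Ici 0) := by
  have hasDerivWithinAt {F : ℝ → ℝ} (hF : ContinuousOn F (Ici 0)) (t : ℝ) (ht : 0 ≤ t) :
      HasDerivWithinAt (rlIntegral 1 F) (F t) (Ici t) t := by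
    simp only [funext (rlIntegral_one_apply F)]
    have hFt : ContinuousOn F (Ici t) := hF.mono (Ici_subset_Ici.2 ht)
    refine intervalIntegral.integral_hasDerivWithinAt_right
      (hF.mono (uIcc_of_le ht ▸ Icc_subset_Ici_self)).intervalIntegrable (t := Ioi t) ?_
      ((hFt t self_mem_Ici).mono Ioi_subset_Ici_self)
    exact ⟨Ioi t, self_mem_nhdsWithin,
      (hFt.mono Ioi_subset_Ici_self).aestronglyMeasurable measurableSet_Ioi⟩
  intro t ht
  refine (uniqueDiffWithinAt_Ici t).eq_deriv _ (hasDerivWithinAt hf t ht) ?_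
  exact (hasDerivWithinAt hg t ht).congr (h.mono (Ici_subset_Ici.2 ht)) (h ht)

/-- Applying `J^α` to `J^(1-α) (f - f(0)) = J^1 v` and cancelling `J^1` turns the differential
equation into a Volterra equation. -/
theorem eq_add_rlIntegral_of_hasCaputoDerivAt {α : ℝ} (hα0 : 0 ≤ α) (hα1 : α ≤ 1) {v : ℝ → ℝ}
    (hf : ContinuousOn f (Ici 0)) (hv : ContinuousOn v (Ici 0))
    (h : ∀ t, 0 < t → HasCaputoDerivAt α f (v t) t) (ht : 0 ≤ t) :
    f t = f 0 + rlIntegral α v t := by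
  have hα1' : 0 ≤ 1 - α := sub_nonneg.2 hα1
  have increment : ContinuousOn (fun s => f s - f 0) (Ici 0) := hf.sub continuousOn_const
  have integrated (t : ℝ) (ht : 0 ≤ t) :
      rlIntegral (1 - α) (fun s => f s - f 0) t = rlIntegral 1 v t := by
    have ftc := intervalIntegral.integral_eq_sub_of_hasDerivAt_of_le ht
      ((continuousOn_rlIntegral hα1' increment).mono Icc_subset_Ici_self) (fun x hx => h x hx.1)
      (hv.mono (uIcc_of_le ht ▸ Icc_subset_Ici_self)).intervalIntegrable
    have initial : rlIntegral (1 - α) (fun s => f s - f 0) 0 = 0 := by simp [rlIntegral]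
    rw [rlIntegral_one_apply, ftc, initial, sub_zero]
  have cancelled : EqOn (fun s => f s - f 0) (rlIntegral α v) (Ici 0) := by
    refine eq_of_rlIntegral_one_eq increment (continuousOn_rlIntegral hα0 hv) fun t ht => ?_
    calc rlIntegral 1 (fun s => f s - f 0) t
        = rlIntegral α (rlIntegral (1 - α) fun s => f s - f 0) t := by
          rw [rlIntegral_rlIntegral hα0 hα1' increment ht, add_sub_cancel]
      _ = rlIntegral α (rlIntegral 1 v) t := rlIntegral_congr ht fun s hs => integrated s hs.1
      _ = rlIntegral 1 (rlIntegral α v) t := by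
          rw [rlIntegral_rlIntegral hα0 zero_le_one hv ht,
            rlIntegral_rlIntegral zero_le_one hα0 hv ht, add_comm]
  linarith [cancelled ht]

end RiemannLiouville

section MittagLeffler

variable {α : ℝ}

theorem rpow_mul_exp_neg_le_Gamma {M s : ℝ} (hM : 0 ≤ M) (hs : 1 ≤ s) :
    M ^ (s - 1) * Real.exp (-(M + 1)) ≤ Real.Gamma s := by
  have integrable := Real.GammaIntegral_convergent (one_pos.trans_le hs)
  have window : Ioc M (M + 1) ⊆ Ioi 0 := fun x hx => hM.trans_lt hx.1
  calc M ^ (s - 1) * Real.exp (-(M + 1))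
      = ∫ _ in Ioc M (M + 1), M ^ (s - 1) * Real.exp (-(M + 1)) := by simp
    _ ≤ ∫ x in Ioc M (M + 1), Real.exp (-x) * x ^ (s - 1) := by
        refine setIntegral_mono_on (integrableOn_const (by simp)) (integrable.mono_set window)
          measurableSet_Ioc fun x hx => ?_
        rw [mul_comm]
        gcongr
        exacts [hx.2, hx.1.le]
    _ ≤ ∫ x in Ioi 0, Real.exp (-x) * x ^ (s - 1) := by
        refine setIntegral_mono_set integrable ?_ window.eventuallyLE
        filter_upwards [ae_restrict_mem measurableSet_Ioi] with x hx
        exact mul_nonneg (Real.exp_pos _).le (Real.rpow_nonneg (le_of_lt hx) _)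
    _ = Real.Gamma s := (Real.Gamma_eq_integral (one_pos.trans_le hs)).symm

theorem summable_pow_div_Gamma (hα : 0 < α) (γ w : ℝ) :
    Summable fun r : ℕ => w ^ r / Real.Gamma (α * r + γ) := by
  -- `M` makes the lower bound `M ^ (α * r + γ - 1)` for the Gamma function outgrow `(2 * |w|) ^ r`.
  obtain ⟨M, hM, hMα⟩ : ∃ M : ℝ, 0 < M ∧ M ^ α = 2 * |w| + 1 :=
    ⟨(2 * |w| + 1) ^ α⁻¹, by positivity, Real.rpow_inv_rpow (by positivity) hα.ne'⟩
  have ratio_lt_one : |w| / (2 * |w| + 1) < 1 := by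
    rw [div_lt_one (by positivity)]
    linarith [abs_nonneg w]
  have geometric := (summable_geometric_of_lt_one (by positivity) ratio_lt_one).mul_left
    (Real.exp (M + 1) * M ^ (1 - γ))
  have argument_tendsto : Tendsto (fun r : ℕ => α * r + γ) atTop atTop :=
    tendsto_atTop_add_const_right _ _ (tendsto_natCast_atTop_atTop.const_mul_atTop hα)
  refine geometric.of_norm_bounded_eventually_nat ?_
  filter_upwards [argument_tendsto.eventually_ge_atTop 1] with r hr
  have lower := rpow_mul_exp_neg_le_Gamma hM.le hr
  have lower_pos : 0 < M ^ (α * r + γ - 1) * Real.exp (-(M + 1)) := by positivity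
  rw [norm_div, norm_pow, Real.norm_eq_abs, Real.norm_of_nonneg (lower_pos.le.trans lower)]
  calc |w| ^ r / Real.Gamma (α * r + γ)
      ≤ |w| ^ r / (M ^ (α * r + γ - 1) * Real.exp (-(M + 1))) := by gcongr
    _ = Real.exp (M + 1) * M ^ (1 - γ) * (|w| / (2 * |w| + 1)) ^ r := by
        rw [show α * r + γ - 1 = α * r - (1 - γ) by ring, Real.rpow_sub hM,
          Real.rpow_mul_natCast hM.le, hMα, Real.exp_neg, div_pow]
        field_simp

theorem mittagLeffler_one (α γ w : ℝ) :
    mittagLeffler 1 α γ w = ∑' r : ℕ, w ^ r / Real.Gamma (α * r + γ) := by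
  unfold mittagLeffler
  congr with r
  have hr : (r ! : ℝ) ≠ 0 := by positivity
  rw [add_comm, Real.Gamma_nat_eq_factorial, Real.Gamma_one, mul_one, mul_comm (w ^ r),
    mul_div_mul_left _ _ hr]

theorem hasSum_mittagLeffler_one (hα : 0 < α) (γ w : ℝ) :
    HasSum (fun r : ℕ => w ^ r / Real.Gamma (α * r + γ)) (mittagLeffler 1 α γ w) := by
  rw [mittagLeffler_one]
  exact (summable_pow_div_Gamma hα γ w).hasSum

theorem continuous_mittagLeffler_one (hα : 0 < α) (γ : ℝ) :
    Continuous (mittagLeffler 1 α γ) := by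
  refine continuous_iff_continuousAt.2 fun w => ?_
  have near : ContinuousOn (mittagLeffler 1 α γ) (Icc (w - 1) (w + 1)) := by
    rw [funext (mittagLeffler_one α γ)]
    refine continuousOn_tsum (fun r => by fun_prop)
      (summable_pow_div_Gamma hα γ (|w| + 1)).norm fun r x hx => ?_
    have hx' : ‖x‖ ≤ ‖|w| + 1‖ := by
      rw [Real.norm_eq_abs, Real.norm_of_nonneg (by positivity), abs_le]
      constructor <;> linarith [hx.1, hx.2, neg_abs_le w, le_abs_self w]
    simp only [norm_div, norm_pow]
    gcongr
  exact near.continuousAt (Icc_mem_nhds (by linarith) (by linarith))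

theorem mittagLeffler_one_apply_zero (α γ : ℝ) :
    mittagLeffler 1 α γ 0 = (Real.Gamma γ)⁻¹ := by
  rw [mittagLeffler_one, tsum_eq_single 0 fun r hr => by simp [hr]]
  simp

theorem mittagLeffler_one_one_one (w : ℝ) : mittagLeffler 1 1 1 w = Real.exp w := by
  rw [mittagLeffler_one, Real.exp_eq_exp_ℝ, NormedSpace.exp_eq_tsum_div]
  congr with r
  rw [one_mul, Real.Gamma_nat_eq_factorial]

end MittagLeffler

/-- The resolvent kernel `s ↦ s^(α-1) E_{α,α}(ℓ s^α)` of the Volterra equation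
`m = J^α (ℓ m) + f`: convolution with it is `∑ k, ℓ^k J^(α (k+1))`. -/
noncomputable def mlKernel (α ℓ s : ℝ) : ℝ :=
  s ^ (α - 1) * mittagLeffler 1 α α (ℓ * s ^ α)

section Resolvent

variable {α ℓ t : ℝ} {h m : ℝ → ℝ}

theorem mlKernel_one (ℓ : ℝ) : mlKernel 1 ℓ = fun s => Real.exp (ℓ * s) := by
  ext s
  simp [mlKernel, mittagLeffler_one_one_one]

theorem timeConv_mlKernel_zero (hα : α ≠ 0) (h : ℝ → ℝ) :
    timeConv h (mlKernel α 0) = rlIntegral α h := by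
  have kernel_eq : mlKernel α 0 = fracKernel α := by
    ext s
    rw [mlKernel, zero_mul, mittagLeffler_one_apply_zero, fracKernel, div_eq_mul_inv]
  rw [kernel_eq, rlIntegral_eq_timeConv hα]

theorem hasSum_mlKernel (hα : 0 < α) (ℓ : ℝ) {s : ℝ} (hs : 0 < s) :
    HasSum (fun k : ℕ => ℓ ^ k * fracKernel (α * k + α) s) (mlKernel α ℓ s) := by
  refine ((hasSum_mittagLeffler_one hα α (ℓ * s ^ α)).mul_left (s ^ (α - 1))).congr_fun fun k => ?_
  rw [fracKernel, mul_pow, ← Real.rpow_mul_natCast hs.le, add_sub_assoc, Real.rpow_add hs]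
  ring

theorem intervalIntegrable_mul_mlKernel_sub (hα : 0 < α) (ℓ : ℝ) (hh : ContinuousOn h (Ici 0))
    (ht : 0 ≤ t) : IntervalIntegrable (fun s => h s * mlKernel α ℓ (t - s)) volume 0 t := by
  have hh' : ContinuousOn h (uIcc 0 t) := hh.mono (uIcc_of_le ht ▸ Icc_subset_Ici_self)
  have factor : Continuous fun s => mittagLeffler 1 α α (ℓ * (t - s) ^ α) :=
    (continuous_mittagLeffler_one hα α).comp (continuous_const.mul
      ((Real.continuous_rpow_const hα.le).comp (continuous_sub_left t)))
  exact ((intervalIntegrable_sub_rpow hα t).mul_continuousOn factor.continuousOn).continuousOn_mul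
    hh'

theorem hasSum_pow_mul_rlIntegral (hα : 0 < α) (ℓ : ℝ) (hh : ContinuousOn h (Ici 0))
    (ht : 0 ≤ t) :
    HasSum (fun k : ℕ => ℓ ^ k * rlIntegral (α * k + α) h t) (timeConv h (mlKernel α ℓ) t) := by
  obtain ⟨C, hC⟩ := isCompact_Icc.exists_bound_of_continuousOn
    (hh.mono (Icc_subset_Ici_self : Icc 0 t ⊆ Ici 0))
  have order_pos (k : ℕ) : 0 < α * k + α := by positivity
  have ae_lt : ∀ᵐ s, s ∈ uIoc 0 t → s ∈ Icc 0 t ∧ 0 < t - s := by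
    filter_upwards [compl_mem_ae_iff.2 (measure_singleton t)] with s hst hs
    rw [uIoc_of_le ht] at hs
    exact ⟨Ioc_subset_Icc_self hs, sub_pos.2 (hs.2.lt_of_ne hst)⟩
  have majorant {s : ℝ} (hs : 0 < t - s) := (hasSum_mlKernel hα |ℓ| hs).mul_left C
  have summed : HasSum
      (fun k : ℕ => ∫ s in (0 : ℝ)..t, ℓ ^ k * (h s * fracKernel (α * k + α) (t - s)))
      (timeConv h (mlKernel α ℓ) t) := by
    refine intervalIntegral.hasSum_integral_of_dominated_convergence
      (fun k s => C * (|ℓ| ^ k * fracKernel (α * k + α) (t - s)))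
      (fun k => ?_) (fun k => ?_) ?_ ?_ ?_
    · exact ((intervalIntegrable_mul_fracKernel_sub (order_pos k) hh ht).const_mul
        _).def'.aestronglyMeasurable
    · filter_upwards [ae_lt] with s hs hst
      have kernel_nonneg := fracKernel_nonneg (order_pos k) (hs hst).2.le
      rw [norm_mul, norm_mul, norm_pow, Real.norm_of_nonneg kernel_nonneg, Real.norm_eq_abs ℓ,
        mul_left_comm C]
      gcongr
      exact hC s (hs hst).1
    · filter_upwards [ae_lt] with s hs hst using (majorant (hs hst).2).summable
    · refine (intervalIntegrable_mul_mlKernel_sub hα |ℓ| continuousOn_const ht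
        (h := fun _ => C)).congr_uIoo fun s hs => ?_
      rw [uIoo_of_le ht] at hs
      exact (majorant (sub_pos.2 hs.2)).tsum_eq.symm
    · filter_upwards [ae_lt] with s hs hst
      exact ((hasSum_mlKernel hα ℓ (hs hst).2).mul_left (h s)).congr_fun
        fun k => mul_left_comm _ _ _
  refine summed.congr_fun fun k => ?_
  rw [intervalIntegral.integral_const_mul, rlIntegral_eq_timeConv (order_pos k).ne', timeConv]

theorem rlIntegral_eq_of_volterra {c a : ℝ} (hα : 0 ≤ α) (hm : ContinuousOn m (Ici 0))
    (hh : ContinuousOn h (Ici 0))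
    (volterra : ∀ t, 0 ≤ t → m t = c + rlIntegral α (fun s => ℓ * m s + h s) t)
    (ha : 0 ≤ a) (ht : 0 ≤ t) :
    rlIntegral a m t = c * (t ^ a / Real.Gamma (a + 1)) + rlIntegral (a + α) h t +
      ℓ * rlIntegral (a + α) m t := by
  have hℓm : ContinuousOn (fun s => ℓ * m s) (Ici 0) := continuousOn_const.mul hm
  have source : ContinuousOn (fun s => ℓ * m s + h s) (Ici 0) := hℓm.add hh
  rw [rlIntegral_congr ht fun s hs => volterra s hs.1,
    rlIntegral_add ha continuousOn_const (continuousOn_rlIntegral hα source) ht,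
    rlIntegral_const ha c ht, rlIntegral_rlIntegral ha hα source ht,
    rlIntegral_add (add_nonneg ha hα) hℓm hh ht, rlIntegral_const_mul]
  ring

theorem eq_sum_add_pow_mul_rlIntegral_of_volterra {c : ℝ} (hα : 0 ≤ α)
    (hm : ContinuousOn m (Ici 0)) (hh : ContinuousOn h (Ici 0))
    (volterra : ∀ t, 0 ≤ t → m t = c + rlIntegral α (fun s => ℓ * m s + h s) t) (ht : 0 ≤ t)
    (n : ℕ) :
    m t = ∑ k ∈ Finset.range n, (c * ((ℓ * t ^ α) ^ k / Real.Gamma (α * k + 1)) +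
      ℓ ^ k * rlIntegral (α * k + α) h t) + ℓ ^ n * rlIntegral (α * n) m t := by
  induction n with
  | zero => simp [rlIntegral_zero]
  | succ n ih =>
    rw [Finset.sum_range_succ, add_assoc, ih, Nat.cast_succ, mul_add_one,
      rlIntegral_eq_of_volterra hα hm hh volterra (by positivity) ht, mul_pow,
      ← Real.rpow_mul_natCast ht]
    ring

theorem tendsto_pow_mul_rlIntegral (hα : 0 < α) (ℓ : ℝ) (hm : ContinuousOn m (Ici 0))
    (ht : 0 ≤ t) : Tendsto (fun n : ℕ => ℓ ^ n * rlIntegral (α * n) m t) atTop (𝓝 0) := by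
  obtain ⟨C, hC⟩ := isCompact_Icc.exists_bound_of_continuousOn
    (hm.mono (Icc_subset_Ici_self : Icc 0 t ⊆ Ici 0))
  have majorant := ((summable_pow_div_Gamma hα 1 (|ℓ| * t ^ α)).mul_left C).tendsto_atTop_zero
  refine squeeze_zero_norm (fun n => ?_) majorant
  calc ‖ℓ ^ n * rlIntegral (α * n) m t‖
      ≤ |ℓ| ^ n * (C * (t ^ (α * n) / Real.Gamma (α * n + 1))) := by
        rw [norm_mul, norm_pow, Real.norm_eq_abs]
        gcongr
        exact abs_rlIntegral_le (by positivity) hC ht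
    _ = C * ((|ℓ| * t ^ α) ^ n / Real.Gamma (α * n + 1)) := by
        rw [mul_pow, ← Real.rpow_mul_natCast ht]
        ring

theorem eq_mittagLeffler_add_timeConv_of_volterra {c : ℝ} (hα : 0 < α)
    (hm : ContinuousOn m (Ici 0)) (hh : ContinuousOn h (Ici 0))
    (volterra : ∀ t, 0 ≤ t → m t = c + rlIntegral α (fun s => ℓ * m s + h s) t) (ht : 0 ≤ t) :
    m t = c * mittagLeffler 1 α 1 (ℓ * t ^ α) + timeConv h (mlKernel α ℓ) t := by
  have series := ((hasSum_mittagLeffler_one hα 1 (ℓ * t ^ α)).mul_left c).add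
    (hasSum_pow_mul_rlIntegral hα ℓ hh ht)
  have expansion := series.tendsto_sum_nat.add (tendsto_pow_mul_rlIntegral hα ℓ hm ht)
  simp only [← eq_sum_add_pow_mul_rlIntegral_of_volterra hα.le hm hh volterra ht,
    add_zero] at expansion
  exact tendsto_nhds_unique tendsto_const_nhds expansion

/-- The constant function `1` solves the Volterra equation with `h = -ℓ`. -/
theorem mul_timeConv_one_mlKernel (hα : 0 < α) (ℓ : ℝ) (ht : 0 ≤ t) :
    ℓ * timeConv (fun _ => 1) (mlKernel α ℓ) t = mittagLeffler 1 α 1 (ℓ * t ^ α) - 1 := by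
  have solved := eq_mittagLeffler_add_timeConv_of_volterra (m := fun _ => 1)
    (h := fun _ => -ℓ * 1) (ℓ := ℓ) (c := 1) hα continuousOn_const continuousOn_const
    (fun s hs => by simp [rlIntegral_const hα.le _ hs]) ht
  rw [timeConv_const_mul_left] at solved
  linarith

theorem tendsto_timeConv_mlKernel (hα : 0 < α) (ℓ : ℝ) {H : ℕ → ℝ → ℝ} {C : ℝ}
    (hH : ∀ K, ContinuousOn (H K) (Ici 0)) (hC : ∀ K, ∀ s ∈ Icc 0 t, |H K s| ≤ C)
    (lim : ∀ s ∈ Icc 0 t, Tendsto (H · s) atTop (𝓝 (h s))) (ht : 0 ≤ t) :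
    Tendsto (fun K => timeConv (H K) (mlKernel α ℓ) t) atTop (𝓝 (timeConv h (mlKernel α ℓ) t)) := by
  have Ioc_subset : uIoc 0 t ⊆ Icc 0 t := uIoc_of_le ht ▸ Ioc_subset_Icc_self
  refine intervalIntegral.tendsto_integral_filter_of_dominated_convergence
    (fun s => C * |mlKernel α ℓ (t - s)|) (Eventually.of_forall fun K => ?_)
    (Eventually.of_forall fun K => Eventually.of_forall fun s hs => ?_) ?_
    (Eventually.of_forall fun s hs => (lim s (Ioc_subset hs)).mul_const _)
  · exact (intervalIntegrable_mul_mlKernel_sub hα ℓ (hH K) ht).def'.aestronglyMeasurable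
  · rw [norm_mul]
    exact mul_le_mul_of_nonneg_right (hC K s (Ioc_subset hs)) (abs_nonneg _)
  · simpa using (intervalIntegrable_mul_mlKernel_sub hα ℓ (h := fun _ => 1) continuousOn_const
      ht).abs.const_mul C

end Resolvent

section NatValued

variable {Ω : Type*} [MeasurableSpace Ω] {ν : Measure Ω} {Y : Ω → ℕ}

theorem measureReal_lt_eq_one_sub_sum [IsProbabilityMeasure ν] (hY : Measurable Y) (n : ℕ) :
    ν.real {ω | n < Y ω} = 1 - ∑ k ∈ Finset.range (n + 1), ν.real (Y ⁻¹' {k}) := by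
  have compl_eq : {ω | n < Y ω} = (Y ⁻¹' (Finset.range (n + 1) : Set ℕ))ᶜ := by
    ext ω
    simp
  rw [sum_measureReal_preimage_singleton _ fun k _ => hY (measurableSet_singleton k), compl_eq,
    probReal_compl_eq_one_sub (hY (Finset.measurableSet _))]

theorem hasSum_measureReal_preimage_singleton [IsProbabilityMeasure ν] (hY : Measurable Y) :
    HasSum (fun n => ν.real (Y ⁻¹' {n})) 1 := by
  have total : ∑' n, ν (Y ⁻¹' {n}) = 1 := by
    rw [← measure_iUnion (fun _ _ h => (disjoint_singleton.2 h).preimage Y)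
      fun n => hY (measurableSet_singleton n), ← preimage_iUnion, iUnion_of_singleton,
      preimage_univ, measure_univ]
  have := ENNReal.hasSum_toReal (total.trans_ne ENNReal.one_ne_top)
  rwa [← ENNReal.tsum_toReal_eq fun n => measure_ne_top ν _, total, ENNReal.toReal_one] at this

theorem lintegral_natCast_eq_tsum_measure_lt (hY : Measurable Y) :
    ∫⁻ ω, Y ω ∂ν = ∑' n, ν {ω | n < Y ω} := by
  have measurableSet_lt (n : ℕ) : MeasurableSet {ω | n < Y ω} := hY measurableSet_Ioi
  have layers (ω : Ω) : (Y ω : ENNReal) = ∑' n, {ω | n < Y ω}.indicator 1 ω := by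
    rw [tsum_eq_sum (s := Finset.range (Y ω)) (by simp +contextual [indicator])]
    simp +contextual [indicator, Finset.sum_congr rfl]
  simp only [layers]
  rw [lintegral_tsum fun n => (measurable_one.indicator (measurableSet_lt n)).aemeasurable]
  simp only [lintegral_indicator_one (measurableSet_lt _)]

theorem integrable_natCast_and_integral_eq_of_hasSum [IsFiniteMeasure ν] (hY : Measurable Y) {L : ℝ}
    (h : HasSum (fun n => ν.real {ω | n < Y ω}) L) :
    Integrable (fun ω => (Y ω : ℝ)) ν ∧ ∫ ω, (Y ω : ℝ) ∂ν = L := by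
  have L_nonneg : 0 ≤ L := h.nonneg fun _ => measureReal_nonneg
  have cast_measurable : AEStronglyMeasurable (fun ω => (Y ω : ℝ)) ν :=
    (measurable_from_nat.comp hY).aestronglyMeasurable
  have cast_nonneg : 0 ≤ᵐ[ν] fun ω => (Y ω : ℝ) := Eventually.of_forall fun ω => Nat.cast_nonneg _
  have lintegral_eq : ∫⁻ ω, ENNReal.ofReal (Y ω) ∂ν = ENNReal.ofReal L := by
    rw [← h.tsum_eq, ENNReal.ofReal_tsum_of_nonneg (fun _ => measureReal_nonneg) h.summable]
    simp only [ENNReal.ofReal_natCast, ofReal_measureReal (measure_ne_top ν _),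
      lintegral_natCast_eq_tsum_measure_lt hY]
  refine ⟨⟨cast_measurable, ?_⟩, ?_⟩
  · rw [hasFiniteIntegral_iff_ofReal cast_nonneg, lintegral_eq]
    exact ENNReal.ofReal_lt_top
  · rw [integral_eq_lintegral_of_nonneg_ae cast_nonneg cast_measurable, lintegral_eq,
      ENNReal.toReal_ofReal L_nonneg]

end NatValued

/-- The right-hand side of the forward equations at the state `n`, when `p k` is the probability of
the state `k`. -/
def forwardRate (lam μ ξ : ℝ) (p : ℕ → ℝ) : ℕ → ℝ
  | 0 => -(lam + ξ) * p 0 + μ * p 1 + ξ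
  | n + 1 => -(lam + μ + ξ) * p (n + 1) + lam * p n + μ * p (n + 2)

theorem sum_forwardRate (lam μ ξ : ℝ) (p : ℕ → ℝ) (n : ℕ) :
    ∑ k ∈ Finset.range (n + 1), forwardRate lam μ ξ p k =
      ξ * (1 - ∑ k ∈ Finset.range (n + 1), p k) - lam * p n + μ * p (n + 1) := by
  induction n with
  | zero =>
    simp only [Finset.sum_range_one, zero_add, forwardRate]
    ring
  | succ n ih =>
    rw [Finset.sum_range_succ, ih, Finset.sum_range_succ _ (n + 1), forwardRate]
    ring

section TelescopedSource

variable {p : ℕ → ℝ} {S : ℝ}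

theorem abs_sum_mul_sub_mul_succ_le (a b : ℝ) (hp : ∀ n, 0 ≤ p n) (hS : HasSum p S) (K : ℕ) :
    |∑ n ∈ Finset.range K, (a * p n - b * p (n + 1))| ≤ (|a| + |b|) * S := by
  have sum_le (K : ℕ) : ∑ n ∈ Finset.range K, p n ≤ S := sum_le_hasSum _ (fun n _ => hp n) hS
  have sum_succ_le : ∑ n ∈ Finset.range K, p (n + 1) ≤ S := by
    linarith [sum_le (K + 1), Finset.sum_range_succ' p K, hp 0]
  rw [Finset.sum_sub_distrib, ← Finset.mul_sum, ← Finset.mul_sum, add_mul]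
  refine (abs_sub _ _).trans (add_le_add ?_ ?_) <;>
    rw [abs_mul, abs_of_nonneg (Finset.sum_nonneg fun n _ => hp _)]
  exacts [mul_le_mul_of_nonneg_left (sum_le K) (abs_nonneg a),
    mul_le_mul_of_nonneg_left sum_succ_le (abs_nonneg b)]

theorem tendsto_sum_mul_sub_mul_succ (a b : ℝ) (hS : HasSum p S) :
    Tendsto (fun K => ∑ n ∈ Finset.range K, (a * p n - b * p (n + 1))) atTop
      (𝓝 ((a - b) * S + b * p 0)) := by
  have hS' : HasSum (fun n => p (n + 1)) (S - p 0) := by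
    simpa using (hasSum_nat_add_iff' 1).2 hS
  convert ((hS.mul_left a).sub (hS'.mul_left b)).tendsto_sum_nat using 2
  ring

end TelescopedSource

/-- The tail probability `P(X_t > n | X_0 = i)`. -/
noncomputable def tailProb {Ω : Type*} [MeasurableSpace Ω] (P : Measure Ω) (X : ℝ≥0 → Ω → ℕ)
    (i n : ℕ) (t : ℝ) : ℝ :=
  (ProbabilityTheory.cond P (X 0 ⁻¹' {i})).real {ω | n < X t.toNNReal ω}

/-- The truncated mean `E[min(X_t, K) | X_0 = i]`, written as a sum of tail probabilities. -/
noncomputable def truncMean {Ω : Type*} [MeasurableSpace Ω] (P : Measure Ω) (X : ℝ≥0 → Ω → ℕ)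
    (i K : ℕ) (t : ℝ) : ℝ :=
  ∑ n ∈ Finset.range K, tailProb P X i n t

namespace IsFractionalQueue

variable {Ω : Type*} [MeasurableSpace Ω] {P : Measure Ω} {α lam μ ξ : ℝ} {X : ℝ≥0 → Ω → ℕ}
  {i : ℕ}

/-- The initial condition excludes `P (X_0 = i) = ∞`, for which the conditional measure is `0`. -/
theorem isProbabilityMeasure_cond (hX : IsFractionalQueue α lam μ ξ P X)
    (hi : P (X 0 ⁻¹' {i}) ≠ 0) :
    IsProbabilityMeasure (ProbabilityTheory.cond P (X 0 ⁻¹' {i})) := by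
  refine (eq_zero_or_isProbabilityMeasure _).resolve_left fun cond_eq_zero => ?_
  simpa [transProb, cond_eq_zero] using hX.initial i hi i

theorem hasCaputoDerivAt_transProb (hX : IsFractionalQueue α lam μ ξ P X)
    (hi : P (X 0 ⁻¹' {i}) ≠ 0) (n : ℕ) {t : ℝ} (ht : 0 < t) :
    HasCaputoDerivAt α (transProb P X i n)
      (forwardRate lam μ ξ (fun k => transProb P X i k t) n) t := by
  cases n with
  | zero => exact hX.caputo_zero i hi t ht
  | succ n => exact hX.caputo_pos i hi (n + 1) n.succ_pos t ht

theorem continuousOn_forwardRate_transProb (hX : IsFractionalQueue α lam μ ξ P X)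
    (hi : P (X 0 ⁻¹' {i}) ≠ 0) (n : ℕ) :
    ContinuousOn (fun s => forwardRate lam μ ξ (fun k => transProb P X i k s) n) (Ici 0) := by
  have continuousOn := hX.continuousOn i hi
  cases n <;> simp only [forwardRate] <;> fun_prop

theorem transProb_eq_add_rlIntegral (hX : IsFractionalQueue α lam μ ξ P X) (hα0 : 0 ≤ α)
    (hα1 : α ≤ 1) (hi : P (X 0 ⁻¹' {i}) ≠ 0) (n : ℕ) {t : ℝ} (ht : 0 ≤ t) :
    transProb P X i n t = (if i = n then 1 else 0) +
      rlIntegral α (fun s => forwardRate lam μ ξ (fun k => transProb P X i k s) n) t := by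
  rw [← hX.initial i hi n]
  exact eq_add_rlIntegral_of_hasCaputoDerivAt hα0 hα1 (hX.continuousOn i hi n)
    (hX.continuousOn_forwardRate_transProb hi n)
    (fun s hs => hX.hasCaputoDerivAt_transProb hi n hs) ht

theorem tailProb_eq_one_sub_sum (hX : IsFractionalQueue α lam μ ξ P X)
    (hi : P (X 0 ⁻¹' {i}) ≠ 0) (n : ℕ) (t : ℝ) :
    tailProb P X i n t = 1 - ∑ k ∈ Finset.range (n + 1), transProb P X i k t :=
  have := hX.isProbabilityMeasure_cond hi
  measureReal_lt_eq_one_sub_sum (hX.measurable _) n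

theorem hasSum_transProb (hX : IsFractionalQueue α lam μ ξ P X)
    (hi : P (X 0 ⁻¹' {i}) ≠ 0) (t : ℝ) : HasSum (fun n => transProb P X i n t) 1 :=
  have := hX.isProbabilityMeasure_cond hi
  hasSum_measureReal_preimage_singleton (hX.measurable _)

theorem continuousOn_tailProb (hX : IsFractionalQueue α lam μ ξ P X)
    (hi : P (X 0 ⁻¹' {i}) ≠ 0) (n : ℕ) : ContinuousOn (tailProb P X i n) (Ici 0) := by
  rw [funext (hX.tailProb_eq_one_sub_sum hi n)]
  exact continuousOn_const.sub (continuousOn_finsetSum _ fun k _ => hX.continuousOn i hi k)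

/-- The forward equations telescope when they are summed over the states `0, …, n`. -/
theorem tailProb_eq_add_rlIntegral (hX : IsFractionalQueue α lam μ ξ P X) (hα0 : 0 ≤ α)
    (hα1 : α ≤ 1) (hi : P (X 0 ⁻¹' {i}) ≠ 0) (n : ℕ) {t : ℝ} (ht : 0 ≤ t) :
    tailProb P X i n t = (if n < i then 1 else 0) + rlIntegral α (fun s =>
      -ξ * tailProb P X i n s + (lam * transProb P X i n s - μ * transProb P X i (n + 1) s)) t := by
  have integrand (s : ℝ) :
      -ξ * tailProb P X i n s + (lam * transProb P X i n s - μ * transProb P X i (n + 1) s) =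
        -1 * ∑ k ∈ Finset.range (n + 1),
          forwardRate lam μ ξ (fun k => transProb P X i k s) k := by
    rw [sum_forwardRate, hX.tailProb_eq_one_sub_sum hi]
    ring
  have initial_sum : ∑ k ∈ Finset.range (n + 1), (if i = k then 1 else 0 : ℝ) =
      1 - if n < i then 1 else 0 := by
    rcases lt_or_ge n i with h | h <;> simp [h, not_lt.2]
  simp only [integrand, rlIntegral_const_mul]
  rw [rlIntegral_sum _ hα0 (fun k _ => hX.continuousOn_forwardRate_transProb hi k) ht,
    hX.tailProb_eq_one_sub_sum hi,
    Finset.sum_congr rfl fun k _ => hX.transProb_eq_add_rlIntegral hα0 hα1 hi k ht,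
    Finset.sum_add_distrib, initial_sum]
  ring

theorem truncMean_eq_add_rlIntegral (hX : IsFractionalQueue α lam μ ξ P X) (hα0 : 0 ≤ α)
    (hα1 : α ≤ 1) (hi : P (X 0 ⁻¹' {i}) ≠ 0) (K : ℕ) {t : ℝ} (ht : 0 ≤ t) :
    truncMean P X i K t = (min K i : ℕ) + rlIntegral α (fun s => -ξ * truncMean P X i K s +
      ∑ n ∈ Finset.range K, (lam * transProb P X i n s - μ * transProb P X i (n + 1) s)) t := by
  have initial_sum : ∑ n ∈ Finset.range K, (if n < i then 1 else 0 : ℝ) = (min K i : ℕ) := by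
    have filter_eq : (Finset.range K).filter (· < i) = Finset.range (min K i) := by
      ext n
      simp
    rw [Finset.sum_boole, filter_eq, Finset.card_range]
  simp only [truncMean, Finset.mul_sum, ← Finset.sum_add_distrib]
  rw [rlIntegral_sum _ hα0 (fun n _ => ?_) ht, ← initial_sum, ← Finset.sum_add_distrib]
  · exact Finset.sum_congr rfl fun n _ => hX.tailProb_eq_add_rlIntegral hα0 hα1 hi n ht
  · exact (continuousOn_const.mul (hX.continuousOn_tailProb hi n)).add
      ((continuousOn_const.mul (hX.continuousOn i hi n)).sub
        (continuousOn_const.mul (hX.continuousOn i hi (n + 1))))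

theorem hasSum_tailProb (hX : IsFractionalQueue α lam μ ξ P X) (hα0 : 0 < α)
    (hα1 : α ≤ 1) (hi : P (X 0 ⁻¹' {i}) ≠ 0) {t : ℝ} (ht : 0 ≤ t) :
    HasSum (fun n => tailProb P X i n t) (i * mittagLeffler 1 α 1 (-ξ * t ^ α) +
      timeConv (fun s => lam - μ + μ * transProb P X i 0 s) (mlKernel α (-ξ)) t) := by
  let source (K : ℕ) (s : ℝ) : ℝ :=
    ∑ n ∈ Finset.range K, (lam * transProb P X i n s - μ * transProb P X i (n + 1) s)
  have source_continuousOn (K : ℕ) : ContinuousOn (source K) (Ici 0) :=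
    continuousOn_finsetSum _ fun n _ => (continuousOn_const.mul (hX.continuousOn i hi n)).sub
      (continuousOn_const.mul (hX.continuousOn i hi (n + 1)))
  have truncMean_continuousOn (K : ℕ) : ContinuousOn (truncMean P X i K) (Ici 0) :=
    continuousOn_finsetSum _ fun n _ => hX.continuousOn_tailProb hi n
  have solved (K : ℕ) : truncMean P X i K t =
      (min K i : ℕ) * mittagLeffler 1 α 1 (-ξ * t ^ α) + timeConv (source K) (mlKernel α (-ξ)) t :=
    eq_mittagLeffler_add_timeConv_of_volterra hα0 (truncMean_continuousOn K)
      (source_continuousOn K) (fun s hs => hX.truncMean_eq_add_rlIntegral hα0.le hα1 hi K hs) ht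
  have initial_tendsto : Tendsto (fun K => ((min K i : ℕ) : ℝ)) atTop (𝓝 i) :=
    tendsto_const_nhds.congr' <| by
      filter_upwards [eventually_ge_atTop i] with K hK
      rw [min_eq_right hK]
  have source_tendsto (s : ℝ) :
      Tendsto (source · s) atTop (𝓝 (lam - μ + μ * transProb P X i 0 s)) := by
    simpa only [mul_one] using tendsto_sum_mul_sub_mul_succ lam μ (hX.hasSum_transProb hi s)
  refine (hasSum_iff_tendsto_nat_of_nonneg (fun _ => measureReal_nonneg) _).2 ?_
  refine Tendsto.congr (fun K => (solved K).symm) ((initial_tendsto.mul_const _).add ?_)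
  exact tendsto_timeConv_mlKernel hα0 (-ξ) source_continuousOn
    (fun K s _ => abs_sum_mul_sub_mul_succ_le lam μ (fun _ => measureReal_nonneg)
      (hX.hasSum_transProb hi s) K) (fun s _ => source_tendsto s) ht

theorem integrable_and_integral_eq (hX : IsFractionalQueue α lam μ ξ P X) (hα0 : 0 < α)
    (hα1 : α ≤ 1) (hi : P (X 0 ⁻¹' {i}) ≠ 0) (t : ℝ≥0) :
    Integrable (fun ω => (X t ω : ℝ)) (ProbabilityTheory.cond P (X 0 ⁻¹' {i})) ∧
    ∫ ω, (X t ω : ℝ) ∂(ProbabilityTheory.cond P (X 0 ⁻¹' {i})) =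
      i * mittagLeffler 1 α 1 (-ξ * (t : ℝ) ^ α) +
        μ * timeConv (transProb P X i 0) (mlKernel α (-ξ)) t +
        (lam - μ) * timeConv (fun _ => 1) (mlKernel α (-ξ)) t := by
  have := hX.isProbabilityMeasure_cond hi
  have tail_sum := hX.hasSum_tailProb hα0 hα1 hi t.coe_nonneg
  simp only [tailProb, Real.toNNReal_coe] at tail_sum
  obtain ⟨integrable, integral_eq⟩ :=
    integrable_natCast_and_integral_eq_of_hasSum (hX.measurable t) tail_sum
  refine ⟨integrable, ?_⟩
  have const_integrable := intervalIntegrable_mul_mlKernel_sub hα0 (-ξ)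
    (h := fun _ => (lam - μ) * 1) continuousOn_const t.coe_nonneg
  have idle_integrable := intervalIntegrable_mul_mlKernel_sub hα0 (-ξ)
    (h := fun s => μ * transProb P X i 0 s) (continuousOn_const.mul (hX.continuousOn i hi 0))
    t.coe_nonneg
  have split := timeConv_add_left const_integrable idle_integrable
  rw [timeConv_const_mul_left, timeConv_const_mul_left] at split
  simp only [mul_one] at split
  rw [integral_eq, split]
  ring

end IsFractionalQueue

theorem mainTheorem3_general {Ω : Type*} [MeasurableSpace Ω] (P : Measure Ω)
    (α lam μ ξ : ℝ) (hα0 : 0 < α) (hα1 : α ≤ 1)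
    (X : ℝ≥0 → Ω → ℕ) (hX : IsFractionalQueue α lam μ ξ P X)
    (i : ℕ) (hi : P (X 0 ⁻¹' {i}) ≠ 0) (t : ℝ≥0) :
    Integrable (fun ω => (X t ω : ℝ)) (ProbabilityTheory.cond P (X 0 ⁻¹' {i})) ∧
    IntervalIntegrable (fun s : ℝ => transProb P X i 0 s *
      ((t - s) ^ (α - 1) * mittagLeffler 1 α α (-ξ * (t - s) ^ α))) volume 0 t ∧
    (ξ ≠ 0 →
      ∫ ω, (X t ω : ℝ) ∂(ProbabilityTheory.cond P (X 0 ⁻¹' {i})) =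
        i * mittagLeffler 1 α 1 (-ξ * (t : ℝ) ^ α)
        + μ * timeConv (transProb P X i 0)
            (fun s => s ^ (α - 1) * mittagLeffler 1 α α (-ξ * s ^ α)) t
        + (lam - μ) / ξ * (1 - mittagLeffler 1 α 1 (-ξ * (t : ℝ) ^ α))) ∧
    (ξ = 0 →
      ∫ ω, (X t ω : ℝ) ∂(ProbabilityTheory.cond P (X 0 ⁻¹' {i})) =
        i + μ * rlIntegral α (transProb P X i 0) t
        + (lam - μ) * (t : ℝ) ^ α / Real.Gamma (α + 1)) ∧
    (α = 1 → ξ ≠ 0 →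
      ∫ ω, (X t ω : ℝ) ∂(ProbabilityTheory.cond P (X 0 ⁻¹' {i})) =
        i * Real.exp (-ξ * t)
        + μ * timeConv (transProb P X i 0) (fun s => Real.exp (-ξ * s)) t
        + (lam - μ) / ξ * (1 - Real.exp (-ξ * t))) := by
  obtain ⟨integrable, mean_eq⟩ := hX.integrable_and_integral_eq hα0 hα1 hi t
  have nondegenerate (hξ : ξ ≠ 0) : timeConv (fun _ => 1) (mlKernel α (-ξ)) t =
      (1 - mittagLeffler 1 α 1 (-ξ * (t : ℝ) ^ α)) / ξ := by
    rw [eq_div_iff hξ]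
    linarith [mul_timeConv_one_mlKernel hα0 (-ξ) t.coe_nonneg]
  refine ⟨integrable, intervalIntegrable_mul_mlKernel_sub hα0 (-ξ) (hX.continuousOn i hi 0)
    t.coe_nonneg, fun hξ => ?_, fun hξ => ?_, fun hα hξ => ?_⟩
  · rw [mean_eq, nondegenerate hξ, div_mul_eq_mul_div, mul_div_assoc]
    rfl
  · rw [mean_eq, hξ, neg_zero, zero_mul, mittagLeffler_one_apply_zero, Real.Gamma_one, inv_one,
      mul_one, timeConv_mlKernel_zero hα0.ne', timeConv_mlKernel_zero hα0.ne',
      rlIntegral_const hα0.le 1 t.coe_nonneg, one_mul, mul_div_assoc]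
  · subst hα
    rw [mean_eq, nondegenerate hξ, mlKernel_one, Real.rpow_one, mittagLeffler_one_one_one,
      div_mul_eq_mul_div, mul_div_assoc]

theorem mainTheorem3 {Ω : Type*} [MeasurableSpace Ω] (P : Measure Ω) [IsProbabilityMeasure P]
    (α lam μ ξ : ℝ) (hα0 : 0 < α) (hα1 : α ≤ 1) (hlam : 0 < lam) (hμ : 0 < μ) (hξ : 0 ≤ ξ)
    (X : ℝ≥0 → Ω → ℕ) (hX : IsFractionalQueue α lam μ ξ P X)
    (i : ℕ) (hi : P (X 0 ⁻¹' {i}) ≠ 0) (t : ℝ≥0) :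
    Integrable (fun ω => (X t ω : ℝ)) (ProbabilityTheory.cond P (X 0 ⁻¹' {i})) ∧
    IntervalIntegrable (fun s : ℝ => transProb P X i 0 s *
      ((t - s) ^ (α - 1) * mittagLeffler 1 α α (-ξ * (t - s) ^ α))) volume 0 t ∧
    (0 < ξ →
      ∫ ω, (X t ω : ℝ) ∂(ProbabilityTheory.cond P (X 0 ⁻¹' {i})) =
        i * mittagLeffler 1 α 1 (-ξ * (t : ℝ) ^ α)
        + μ * timeConv (transProb P X i 0)
            (fun s => s ^ (α - 1) * mittagLeffler 1 α α (-ξ * s ^ α)) t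
        + (lam - μ) / ξ * (1 - mittagLeffler 1 α 1 (-ξ * (t : ℝ) ^ α))) ∧
    (ξ = 0 →
      ∫ ω, (X t ω : ℝ) ∂(ProbabilityTheory.cond P (X 0 ⁻¹' {i})) =
        i + μ * rlIntegral α (transProb P X i 0) t
        + (lam - μ) * (t : ℝ) ^ α / Real.Gamma (α + 1)) ∧
    (α = 1 → 0 < ξ →
      ∫ ω, (X t ω : ℝ) ∂(ProbabilityTheory.cond P (X 0 ⁻¹' {i})) =
        i * Real.exp (-ξ * t)
        + μ * timeConv (transProb P X i 0) (fun s => Real.exp (-ξ * s)) t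
        + (lam - μ) / ξ * (1 - Real.exp (-ξ * t))) := by
  have ⟨h_int, h_conv, h_ne, h_zero, h_one⟩ := mainTheorem3_general P α lam μ ξ hα0 hα1 X hX i hi t
  exact ⟨h_int, h_conv, fun hξ => h_ne hξ.ne', h_zero, fun hα hξ => h_one hα hξ.ne'⟩
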